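/- Let $k$ be a finite field with $q$ elements. Characters take values in a fixed algebraically closed field $K$ of characteristic $0$ (for instance $\overline{\mathbb Q}$). Characters $\eta$ of $k^\times$ (including the trivial one $\varepsilon$) are extended to $k$ by $\eta(0)=0$, and $\overline\eta=\eta^{-1}$. Fix a non-trivial additive character $\psi$ of $k$ and put $$g(\eta)=-\sum_{x\in k^\times}\psi(x)\eta(x),\quad g^\circ(\eta)=\begin{cases}q\,g(\eta)&(\eta=\varepsilon)\\ g(\eta)&(\eta\ne\varepsilon)\end{cases},\quad j(\eta_1,\eta_2)=-\sum_{x\in k}\eta_1(x)\eta_2(1-x),$$ $$(\alpha)_\nu=\frac{g(\alpha\nu)}{g(\alpha)},\qquad (\alpha)^\circ_\nu=\frac{g^\circ(\alpha\nu)}{g^\circ(\alpha)},$$ $$F_4(\alpha;\beta;\gamma_1,\gamma_2;z_1,z_2)=\frac1{(1-q)^2}\sum_{\nu_1,\nu_2\in\widehat{k^\times}}\frac{(\alpha)_{\nu_1\nu_2}(\beta)_{\nu_1\nu_2}}{(\gamma_1)^\circ_{\nu_1}(\gamma_2)^\circ_{\nu_2}(\varepsilon)^\circ_{\nu_1}(\varepsilon)^\circ_{\nu_2}}\,\nu_1(z_1)\nu_2(z_2).$$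 Let $d\ge 1$ divide $q-1$, let $\mu_d\subset k^\times$ be the group of $d$-th roots of unity, let $\varphi$ be a generator of $\widehat{k^\times}$, and put $\varphi_d=\varphi^{(q-1)/d}$ and $\chi=\varphi|_{\mu_d}$. Let $a,b,c_1,c_2$ be integers with $\gcd(d,a)=\gcd(d,b)=\gcd(d,c_i-a)=\gcd(d,c_i-b)=1$ for $i=1,2$, and let $\lambda_1,\lambda_2\in k\setminus\{0,1\}$. For $n\in\mathbb Z$ let $\langle n\rangle\in\{0,\dots,d-1\}$ be the representative of $n$ modulo $d$, and let $S_{4,\lambda}$ be the affine surface over $k$ $$y^d=x_1^{\langle a\rangle}x_2^{\langle b\rangle}(1-x_1)^{\langle c_1-a\rangle}(1-x_2)^{\langle c_2-b\rangle}(1-\lambda_1x_1)^{\langle a-c_1-c_2\rangle}(1-\lambda_2x_2)^{\langle b-c_1-c_2\rangle}(1-\lambda_1x_1-\lambda_2x_2)^{\langle c_1+c_2-a-b\rangle}$$ (a factor with exponent $0$ is the constant $1$), on which $\xi\in\mu_d$ acts by $(x_1,x_2,y)\mapsto(x_1,x_2,\xi y)$. With $F$ the $q$-Frobenius, let $$N_1(S_{4,\lambda};\chi^m)=\frac1d\sum_{\xi\in\mu_d}\chi^m(\xi)\,\#\{P\in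 S_{4,\lambda}(\overline k)\mid F(P)=\xi\cdot P\}\qquad(m\in\mathbb Z/d\mathbb Z).$$ Then $N_1(S_{4,\lambda};\chi^m)=q^2$ if $m=0$. If $m\neq0$ in $\mathbb Z/d\mathbb Z$ and $d$ divides none of $a-c_1-c_2$, $b-c_1-c_2$, $c_1+c_2-a-b$, then $$N_1(S_{4,\lambda};\chi^m)=J\cdot F_4\big(\alpha;\beta;\gamma_1,\gamma_2;\lambda_1(1-\lambda_2),\lambda_2(1-\lambda_1)\big)+S_0+S_1+S_2,$$ where $\alpha=\varphi_d^{ma}$, $\beta=\varphi_d^{mb}$, $\gamma_i=\varphi_d^{mc_i}$, $J=j(\alpha,\overline\alpha\gamma_1)\,j(\beta,\overline\beta\gamma_2)$ and $$\begin{aligned}S_0&=\alpha\beta(-1)\,j(\alpha\overline{\gamma_2},\beta\overline{\gamma_1})\,\overline{\gamma_1}(\lambda_1)\overline{\gamma_2}(\lambda_2),\\ S_1&=j(\overline{\alpha\beta}\gamma_1\gamma_2,\beta)\,\overline{\gamma_1}(\lambda_1)\,\overline\alpha\gamma_1(\lambda_1-1)\,\overline\beta(\lambda_2),\\ S_2&=j(\overline{\alpha\beta}\gamma_1\gamma_2,\alpha)\,\overline{\gamma_2}(\lambda_2)\,\overline\beta\gamma_2(\lambda_2-1)\,\overline\alpha(\lambda_1).\end{aligned}$$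 Moreover, if the representatives $\langle n\rangle$ are taken in $\{1,\dots,d\}$ instead (so that all seven factors occur in the equation), then both formulas hold without the condition that $d$ divides none of the three integers. -/

import Mathlib

noncomputable section

namespace AppellFF

/-! ### Gauss sums, Jacobi sums and Appell's function `F₄` over a finite field

`MulChar k K` is the group of characters of `kˣ`, extended by `η 0 = 0` (also for the trivial
character `1`). -/

section Hypergeometric

variable {k K : Type*} [Field k] [Fintype k] [Field K]

/-- The Gauss sum `g(η) = - ∑_{x ≠ 0} ψ(x) η(x)`. -/
def g (ψ : AddChar k K) (η : MulChar k K) : K := - gaussSum η ψ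

open Classical in
/-- `g°(η) = q ^ δ(η) g(η)`, where `δ(η)` is `1` if `η` is trivial and `0` otherwise. -/
def gCirc (ψ : AddChar k K) (η : MulChar k K) : K :=
  (Fintype.card k : K) ^ (if η = 1 then 1 else 0) * g ψ η

/-- The Jacobi sum `j(η₁, η₂) = - ∑_{x₁ + x₂ = 1} η₁(x₁) η₂(x₂)`. -/
def j (η₁ η₂ : MulChar k K) : K := - jacobiSum η₁ η₂

/-- The Pochhammer symbol `(α)_ν = g(αν) / g(α)`. -/
def poch (ψ : AddChar k K) (α ν : MulChar k K) : K := g ψ (α * ν) / g ψ α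

/-- The Pochhammer symbol `(α)_ν° = g°(αν) / g°(α)`. -/
def pochCirc (ψ : AddChar k K) (α ν : MulChar k K) : K := gCirc ψ (α * ν) / gCirc ψ α

/-- Appell's function `F₄(α; β; γ₁, γ₂; z₁, z₂)` over `k`; the sum is over the finite set of all
pairs of characters of `kˣ`. -/
def F4 (ψ : AddChar k K) (α β γ₁ γ₂ : MulChar k K) (z₁ z₂ : k) : K :=
  1 / (1 - (Fintype.card k : K)) ^ 2 *
    ∑ᶠ ν : MulChar k K × MulChar k K,
      poch ψ α (ν.1 * ν.2) * poch ψ β (ν.1 * ν.2) /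
        (pochCirc ψ γ₁ ν.1 * pochCirc ψ γ₂ ν.2 * pochCirc ψ 1 ν.1 * pochCirc ψ 1 ν.2) *
        (ν.1 z₁ * ν.2 z₂)

/-- `J = j(α, α⁻¹γ₁) j(β, β⁻¹γ₂)`. -/
def J (α β γ₁ γ₂ : MulChar k K) : K := j α (α⁻¹ * γ₁) * j β (β⁻¹ * γ₂)

def S0 (α β γ₁ γ₂ : MulChar k K) (x y : k) : K :=
  (α * β) (-1) * j (α * γ₂⁻¹) (β * γ₁⁻¹) * γ₁⁻¹ x * γ₂⁻¹ y

def S1 (α β γ₁ γ₂ : MulChar k K) (x y : k) : K :=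
  j ((α * β)⁻¹ * γ₁ * γ₂) β * γ₁⁻¹ x * (α⁻¹ * γ₁) (x - 1) * β⁻¹ y

def S2 (α β γ₁ γ₂ : MulChar k K) (x y : k) : K :=
  j ((α * β)⁻¹ * γ₁ * γ₂) α * γ₂⁻¹ y * (β⁻¹ * γ₂) (y - 1) * α⁻¹ x

end Hypergeometric

/-! ### Twisted point counts -/

/-- `N_r(V; χ) = (1 / #G) ∑_{g ∈ G} χ(g) #{x ∈ V(k̄) | F^r(x) = g x}` for a finite abelian
group `G` acting on the set `X = V(k̄)` of geometric points with `q`-Frobenius `F`. -/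
def N (X : Type*) {G K : Type*} [CommGroup G] [MulAction G X] [Field K] (F : X → X) (χ : G →* Kˣ)
    (r : ℕ) : K :=
  1 / (Nat.card G : K) * ∑ᶠ g : G, (χ g : K) * (Nat.card {x : X // F^[r] x = g • x} : K)

/-- The geometric points `(x₁, x₂, y)` of the affine surface `y ^ d = f(x₁, x₂)` over `k`. -/
@[ext]
structure CyclicSurface {k : Type*} [Field k] (d : ℕ) (f : MvPolynomial (Fin 2) k) where
  x : Fin 2 → AlgebraicClosure k
  y : AlgebraicClosure k
  eqn : y ^ d = MvPolynomial.aeval x f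

namespace CyclicSurface

variable {k : Type*} [Field k] {d : ℕ} {f : MvPolynomial (Fin 2) k}

/-- The action `ξ • (x₁, x₂, y) = (x₁, x₂, ξ y)` of the group `μ_d ⊆ kˣ`. -/
instance : MulAction (rootsOfUnity d k) (CyclicSurface d f) where
  smul ξ P :=
    { x := P.x
      y := algebraMap k (AlgebraicClosure k) ((ξ : kˣ) : k) * P.y
      eqn := by
        have h : (((ξ : kˣ) : k)) ^ d = 1 := by
          have := (mem_rootsOfUnity d (ξ : kˣ)).1 ξ.2
          rw [← Units.val_pow_eq_pow_val, this, Units.val_one]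
        rw [mul_pow, ← map_pow, h, map_one, one_mul, P.eqn] }
  one_smul P := by
    refine CyclicSurface.ext rfl ?_
    change algebraMap k (AlgebraicClosure k) (1 : k) * P.y = P.y
    simp
  mul_smul ξ ζ P := by
    refine CyclicSurface.ext rfl ?_
    change algebraMap k (AlgebraicClosure k) (((ξ : kˣ) : k) * ((ζ : kˣ) : k)) * P.y =
      algebraMap k (AlgebraicClosure k) ((ξ : kˣ) : k) *
        (algebraMap k (AlgebraicClosure k) ((ζ : kˣ) : k) * P.y)
    rw [map_mul, mul_assoc]

/-- The `q`-Frobenius `(x₁, x₂, y) ↦ (x₁ ^ q, x₂ ^ q, y ^ q)`, `q = #k`. -/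
def frob [Fintype k] (P : CyclicSurface d f) : CyclicSurface d f where
  x i := P.x i ^ Fintype.card k
  y := P.y ^ Fintype.card k
  eqn := by
    have h := congrArg (FiniteField.frobeniusAlgHom k (AlgebraicClosure k)) P.eqn
    rw [map_pow] at h
    rw [MvPolynomial.comp_aeval_apply] at h
    simpa [FiniteField.frobeniusAlgHom_apply] using h

end CyclicSurface

/-- The representative of `n` modulo `d` in `{0, …, d - 1}`. -/
def res (d : ℕ) (n : ℤ) : ℕ := (n % (d : ℤ)).toNat

/-- The representative of `n` modulo `d` in `{1, …, d}`. -/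
def posRes (d : ℕ) (n : ℤ) : ℕ := if (d : ℤ) ∣ n then d else res d n

open MvPolynomial in
/-- The product of powers of linear forms on the right-hand side of the equation `y ^ d = …` of
the surface attached to `F₄`; `e n` is the exponent chosen for the integer `n`. -/
def poly4 {k : Type*} [Field k] (e : ℤ → ℕ) (a b c₁ c₂ : ℤ) (l₁ l₂ : k) :
    MvPolynomial (Fin 2) k :=
  X 0 ^ e a * X 1 ^ e b * (1 - X 0) ^ e (c₁ - a) * (1 - X 1) ^ e (c₂ - b) *
    (1 - C l₁ * X 0) ^ e (a - c₁ - c₂) * (1 - C l₂ * X 1) ^ e (b - c₁ - c₂) *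
    (1 - C l₁ * X 0 - C l₂ * X 1) ^ e (c₁ + c₂ - a - b)

/-- The surface `S_{4,λ}` (its geometric points), with exponents in `{0, …, d - 1}`. -/
abbrev Surface4 {k : Type*} [Field k] (d : ℕ) (a b c₁ c₂ : ℤ) (l₁ l₂ : k) : Type _ :=
  CyclicSurface d (poly4 (res d) a b c₁ c₂ l₁ l₂)

/-- The variant of the surface `S_{4,λ}` with exponents in `{1, …, d}`. It differs from
`Surface4` (for `d > 1` and `a`, `b`, `c₁ - a`, `c₂ - b` prime to `d`) only if `d` divides one of
`a - c₁ - c₂`, `b - c₁ - c₂`, `c₁ + c₂ - a - b`; then `Surface4` lacks a linear factor. -/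
abbrev Surface4Pos {k : Type*} [Field k] (d : ℕ) (a b c₁ c₂ : ℤ) (l₁ l₂ : k) : Type _ :=
  CyclicSurface d (poly4 (posRes d) a b c₁ c₂ l₁ l₂)

/-- The restriction `χ = φ|_{μ_d}`. -/
def chi {k K : Type*} [Field k] [Field K] (d : ℕ) (φ : MulChar k K) : rootsOfUnity d k →* Kˣ :=
  φ.toUnitHom.comp (rootsOfUnity d k).subtype

/-- `φ_d = φ ^ ((q - 1) / d)`. -/
def phiD {k K : Type*} [Field k] [Fintype k] [Field K] (d : ℕ) (φ : MulChar k K) : MulChar k K :=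
  φ ^ ((Fintype.card k - 1) / d)

/-- `J · F₄(α; β; γ₁, γ₂; x(1 - y), y(1 - x)) + S₀(x, y) + S₁(x, y) + S₂(x, y)`. -/
def rhs4 {k K : Type*} [Field k] [Fintype k] [Field K] (ψ : AddChar k K)
    (α β γ₁ γ₂ : MulChar k K) (x y : k) : K :=
  J α β γ₁ γ₂ * F4 ψ α β γ₁ γ₂ (x * (1 - y)) (y * (1 - x)) +
    (S0 α β γ₁ γ₂ x y + S1 α β γ₁ γ₂ x y + S2 α β γ₁ γ₂ x y)

end AppellFF

end

/-! Both sides are character sums over the plane. On the point-count side, Frobenius multiplies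
every root of `y ^ d = c`, `c ≠ 0`, by `c ^ ((q - 1) / d)`, so counting fibrewise over `k²` gives
the sum of `φ_d ^ m` over the values of the defining polynomial (`N_eq_sum_phiD`).

On the hypergeometric side, the reflection formula turns the denominators of `F₄` into Gauss sums.
Orthogonality in `ν₁, ν₂` then leaves two Kloosterman sums, and a monomial substitution makes the
exponent linear in two of the variables. Summing these out gives `J_mul_F4_eq_sum`: `J · F₄` is a
sum over `(w, n)` of four characters, evaluated at `w`, `n`, a linear form and a conic.

For `z₁ = x(1 - y)`, `z₂ = y(1 - x)`, a birational map `(u, v) ↦ (w, n)` carries this summand to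
that of the surface (`conicTerm_eq_surfaceTerm`). The map misses three lines of the `(w, n)`-plane,
on which the sum collapses to Jacobi sums: these are `-S₀`, `-S₁`, `-S₂` (`sum_conicTerm_eq`). -/

namespace AppellFF

open Finset


/-! ### Gauss sums, Jacobi sums and orthogonality of characters. -/

section CharacterSums

variable {k K : Type*} [Field k] [Field K]

lemma mulChar_ne_zero (χ : MulChar k K) {x : k} (hx : x ≠ 0) : χ x ≠ 0 :=
  ((isUnit_iff_ne_zero.2 hx).map χ).ne_zero

lemma mulChar_inv (χ : MulChar k K) (x : k) : χ x⁻¹ = (χ x)⁻¹ := by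
  rw [← MulChar.inv_apply', MulChar.inv_apply_eq_inv']

lemma mulChar_div (χ : MulChar k K) (x y : k) : χ (x / y) = χ x / χ y := by
  rw [div_eq_mul_inv, map_mul, mulChar_inv, div_eq_mul_inv]

lemma mulChar_neg_one_mul_self (χ : MulChar k K) : χ (-1) * χ (-1) = 1 := by
  rw [← map_mul]; simp

lemma mulChar_neg (χ : MulChar k K) (x : k) : χ (-x) = χ (-1) * χ x := by
  rw [← map_mul, neg_one_mul]

variable [Fintype k]

lemma sum_mul_left {M : Type*} [AddCommMonoid M] {c : k} (hc : c ≠ 0) (f : k → M) :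
    ∑ x, f (c * x) = ∑ x, f x :=
  Fintype.sum_equiv (Equiv.mulLeft₀ c hc) _ _ fun _ => rfl

/-- Substitute by the involution `x ↦ x / (x - 1)` of `k \ {0, 1}`. It brings the Jacobi sum met on
the line `n = (1 - x) / x` into the shape used in `S0`. -/
lemma jacobiSum_eq_mul_jacobiSum (χ η : MulChar k K) :
    jacobiSum χ η = χ (-1) * jacobiSum χ (χ * η)⁻¹ := by
  classical
  rw [jacobiSum_eq_sum_sdiff, jacobiSum_eq_sum_sdiff, mul_sum]
  have key : ∀ x ∈ (univ \ {0, 1} : Finset k), x ≠ 0 ∧ x - 1 ≠ 0 := by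
    intro x hx
    simp only [mem_sdiff, mem_univ, mem_insert, mem_singleton, not_or, true_and] at hx
    exact ⟨hx.1, sub_ne_zero.2 hx.2⟩
  have maps : ∀ x ∈ (univ \ {0, 1} : Finset k), x / (x - 1) ∈ (univ \ {0, 1} : Finset k) := by
    intro x hx
    obtain ⟨h0, h1⟩ := key x hx
    simp only [mem_sdiff, mem_univ, mem_insert, mem_singleton, not_or, true_and]
    refine ⟨div_ne_zero h0 h1, fun h => ?_⟩
    rw [div_eq_one_iff_eq h1] at h
    exact one_ne_zero (by linear_combination h : (1 : k) = 0)
  have inv : ∀ x ∈ (univ \ {0, 1} : Finset k), x / (x - 1) / (x / (x - 1) - 1) = x := by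
    intro x hx
    obtain ⟨h0, h1⟩ := key x hx
    have : x / (x - 1) - 1 = 1 / (x - 1) := by field_simp; ring
    rw [this]; field_simp
  refine sum_nbij' (fun x => x / (x - 1)) (fun x => x / (x - 1)) maps maps inv inv ?_
  intro x hx
  obtain ⟨h0, h1⟩ := key x hx
  have e1 : 1 - x / (x - 1) = -1 / (x - 1) := by field_simp; ring
  have e2 : 1 - x = (-1) * (x - 1) := by ring
  rw [e1, e2]
  simp only [MulChar.inv_apply_eq_inv', MulChar.mul_apply, mulChar_div, map_mul]
  have := mulChar_ne_zero χ h0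
  have := mulChar_ne_zero χ h1
  have := mulChar_ne_zero η h1
  have := mulChar_ne_zero χ (neg_ne_zero.2 (one_ne_zero (α := k)))
  have := mulChar_ne_zero η (neg_ne_zero.2 (one_ne_zero (α := k)))
  have d := mulChar_neg_one_mul_self η
  field_simp
  linear_combination d

lemma sum_mulChar_sub (χ η : MulChar k K) {c : k} (hc : c ≠ 0) :
    ∑ x, χ x * η (c - x) = (χ * η) c * jacobiSum χ η := by
  rw [← sum_mul_left hc, jacobiSum, mul_sum]
  refine sum_congr rfl fun x _ => ?_
  rw [show c - c * x = c * (1 - x) by ring, map_mul, map_mul, MulChar.mul_apply]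
  ring

variable (ψ : AddChar k K)

lemma g_one (hψ : ψ ≠ 1) : g ψ (1 : MulChar k K) = 1 := by
  rw [g, gaussSum_one_left hψ, neg_neg]

lemma sum_mulChar_mul_addChar {χ : MulChar k K} (hχ : χ ≠ 1) (z : k) :
    ∑ x, χ x * ψ (x * z) = - (g ψ χ * χ⁻¹ z) := by
  rcases eq_or_ne z 0 with rfl | hz
  · simp [MulChar.sum_eq_zero_of_ne_one hχ, MulChar.map_zero]
  · have := gaussSum_mulShift_eq χ ψ (Units.mk0 z hz)
    rw [Units.val_mk0] at this
    rw [g, neg_mul, neg_neg, mul_comm, ← this, gaussSum]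
    simp [AddChar.mulShift_apply, mul_comm]

/-- The factor `q` in `g°` is what makes the reflection formula uniform: since `g(ε) = 1`, it would
otherwise fail for the trivial character. -/
lemma g_mul_gCirc_inv (hψ : ψ ≠ 1) (χ : MulChar k K) :
    gCirc ψ χ * g ψ χ⁻¹ = χ (-1) * (Fintype.card k : K) := by
  by_cases h : χ = 1
  · subst h
    simp [gCirc, g_one ψ hψ, MulChar.one_apply]
  · have hp : ψ.IsPrimitive := AddChar.IsPrimitive.of_ne_one hψ
    have h1 := gaussSum_mul_gaussSum_eq_card h hp
    have h2 := mul_gaussSum_inv_eq_gaussSum χ⁻¹ ψ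
    rw [MulChar.inv_apply', inv_neg, inv_one] at h2
    simp only [gCirc, if_neg h, pow_zero, one_mul, g]
    rw [← h2, ← h1]; ring

variable [CharZero K]

lemma card_cast_ne_zero : (Fintype.card k : K) ≠ 0 := by
  exact_mod_cast Fintype.card_ne_zero

lemma g_ne_zero (hψ : ψ ≠ 1) (χ : MulChar k K) : g ψ χ ≠ 0 := by
  intro h
  have := g_mul_gCirc_inv ψ hψ χ⁻¹
  rw [inv_inv, h, mul_zero] at this
  exact mul_ne_zero (mulChar_ne_zero _ (by simp)) card_cast_ne_zero this.symm

lemma gCirc_ne_zero (hψ : ψ ≠ 1) (χ : MulChar k K) : gCirc ψ χ ≠ 0 :=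
  mul_ne_zero (pow_ne_zero _ card_cast_ne_zero) (g_ne_zero ψ hψ χ)

lemma inv_gCirc (hψ : ψ ≠ 1) (χ : MulChar k K) :
    (gCirc ψ χ)⁻¹ = χ (-1) * g ψ χ⁻¹ / (Fintype.card k : K) := by
  have h := g_mul_gCirc_inv ψ hψ χ
  have h0 := gCirc_ne_zero ψ hψ χ
  have hq : (Fintype.card k : K) ≠ 0 := card_cast_ne_zero
  have c := mulChar_neg_one_mul_self χ
  field_simp
  linear_combination (-(Fintype.card k : K)) * c - χ (-1) * h

/-- Using `g°` in the denominator absorbs the degenerate case `χη = ε`; only a pair of trivial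
characters would violate the formula. -/
lemma j_eq_g_mul_g_div_gCirc (hψ : ψ ≠ 1) {χ η : MulChar k K} (hχ : χ ≠ 1) :
    j χ η = g ψ χ * g ψ η / gCirc ψ (χ * η) := by
  rw [eq_div_iff (gCirc_ne_zero ψ hψ _)]
  by_cases h : χ * η = 1
  · obtain rfl : η = χ⁻¹ := eq_inv_of_mul_eq_one_right h
    have := g_mul_gCirc_inv ψ hψ χ
    rw [gCirc, if_neg hχ, pow_zero, one_mul] at this
    rw [this, j, jacobiSum_nontrivial_inv hχ, mul_inv_cancel, gCirc, if_pos rfl, g_one ψ hψ]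
    ring
  · have := jacobiSum_mul_nontrivial h ψ
    simp only [j, gCirc, if_neg h, g, pow_zero]
    linear_combination this

/-- Fourier inversion. It also holds at `z = 0`, where the sum vanishes because `χ` is non-trivial.
-/
lemma mulChar_apply_eq_sum (hψ : ψ ≠ 1) {χ : MulChar k K} (hχ : χ ≠ 1) (z : k) :
    χ z = -(χ (-1) * g ψ χ / (Fintype.card k : K)) * ∑ x, χ⁻¹ x * ψ (x * z) := by
  have h := g_mul_gCirc_inv ψ hψ χ
  rw [gCirc, if_neg hχ, pow_zero, one_mul] at h
  have hq : (Fintype.card k : K) ≠ 0 := card_cast_ne_zero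
  have c := mulChar_neg_one_mul_self χ
  rw [sum_mulChar_mul_addChar ψ (inv_ne_one.2 hχ), inv_inv]
  field_simp
  linear_combination (-χ z * (Fintype.card k : K)) * c - χ (-1) * χ z * h

variable [IsAlgClosed K]

lemma sum_mulChar_apply_eq_zero [Fintype (MulChar k K)] {c : k} (hc : c ≠ 1) :
    ∑ ν : MulChar k K, ν c = 0 := by
  obtain ⟨χ, hχ⟩ := MulChar.exists_apply_ne_one_of_hasEnoughRootsOfUnity k K hc
  refine eq_zero_of_mul_eq_self_left hχ ?_
  rw [mul_sum]
  exact Fintype.sum_equiv (Equiv.mulLeft χ) _ _ fun ν => by simp [MulChar.mul_apply]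

lemma sum_mulChar_apply_one [Fintype (MulChar k K)] :
    ∑ ν : MulChar k K, ν (1 : k) = (Fintype.card k : K) - 1 := by
  have h := MulChar.card_eq_card_units_of_hasEnoughRootsOfUnity k K
  rw [Nat.card_eq_fintype_card, Nat.card_units, Nat.card_eq_fintype_card] at h
  simp only [map_one, sum_const, card_univ, nsmul_eq_mul, mul_one, h]
  rw [Nat.cast_sub Fintype.card_pos]; simp

/-- The Kloosterman sum which is the Mellin inverse of a product of two Gauss sums. -/
lemma sum_mulChar_g_mul_g [Fintype (MulChar k K)] (γ : MulChar k K) {c : k} (hc : c ≠ 0) :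
    ∑ ν : MulChar k K, g ψ (γ * ν)⁻¹ * g ψ ν⁻¹ * ν c =
      ((Fintype.card k : K) - 1) * ∑ u, γ⁻¹ u * ψ (u + c / u) := by
  classical
  have h1 : ∀ ν : MulChar k K, g ψ (γ * ν)⁻¹ * g ψ ν⁻¹ * ν c =
      ∑ u, ∑ w, γ⁻¹ u * ψ u * ψ w * ν (c / (u * w)) := by
    intro ν
    rw [g, g, neg_mul_neg, gaussSum, gaussSum, sum_mul_sum, sum_mul]
    refine sum_congr rfl fun u _ => ?_
    rw [sum_mul]
    refine sum_congr rfl fun w _ => ?_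
    simp only [mul_inv, MulChar.mul_apply, MulChar.inv_apply_eq_inv', mulChar_div, map_mul]
    field_simp
  simp_rw [h1]
  rw [sum_comm, mul_sum]
  refine sum_congr rfl fun u _ => ?_
  rw [sum_comm]
  rcases eq_or_ne u 0 with rfl | hu
  · simp [MulChar.map_zero]
  simp_rw [← mul_sum]
  -- By orthogonality only `u w = c` survives.
  rw [sum_eq_single (c / u)]
  · rw [show c / (u * (c / u)) = 1 by field_simp, sum_mulChar_apply_one, AddChar.map_add_eq_mul]
    ring
  · intro w _ hw
    rw [sum_mulChar_apply_eq_zero, mul_zero]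
    intro h
    apply hw
    have : w ≠ 0 := by rintro rfl; simp at h
    field_simp at h ⊢
    linear_combination -h
  · simp

end CharacterSums


/-! ### `J · F₄` as a character sum over the plane. -/

section IntegralRepresentation

variable {k K : Type*} [Field k] [Fintype k] [Field K] (ψ : AddChar k K)

/-- The monomial change of variables `s = -P w`, `t = -R n`, `u₁ = P`, `u₂ = R w z₂`. -/
lemma exponential_sum_change_of_variables (α β γ₁ γ₂ : MulChar k K) {z₁ z₂ : k} (hz₂ : z₂ ≠ 0) :
    ∑ s, ∑ t, α s * β t * ψ (s + t) * (∑ u, γ₁⁻¹ u * ψ (u + s * t * z₁ / u)) *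
        ∑ u, γ₂⁻¹ u * ψ (u + s * t * z₂ / u) =
      (α * β) (-1) * γ₂⁻¹ z₂ * ∑ w, ∑ n, (α * γ₂⁻¹) w * β n *
        ((∑ P, (α * γ₁⁻¹) P * ψ (P * (1 + n - w))) *
          ∑ R, (β * γ₂⁻¹) R * ψ (R * (-n + w * z₂ + w * n * z₁))) := by
  have lhs : ∑ s, ∑ t, α s * β t * ψ (s + t) * (∑ u, γ₁⁻¹ u * ψ (u + s * t * z₁ / u)) *
        ∑ u, γ₂⁻¹ u * ψ (u + s * t * z₂ / u) =
      ∑ u₁, ∑ s, ∑ u₂, ∑ t, α s * β t * γ₁⁻¹ u₁ * γ₂⁻¹ u₂ *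
        ψ (s + t + (u₁ + s * t * z₁ / u₁) + (u₂ + s * t * z₂ / u₂)) := by
    refine Eq.trans ?_ sum_comm
    refine sum_congr rfl fun s _ => ?_
    have : ∀ t, α s * β t * ψ (s + t) * (∑ u, γ₁⁻¹ u * ψ (u + s * t * z₁ / u)) *
        ∑ u, γ₂⁻¹ u * ψ (u + s * t * z₂ / u) = ∑ u₁, ∑ u₂, α s * β t * γ₁⁻¹ u₁ * γ₂⁻¹ u₂ *
        ψ (s + t + (u₁ + s * t * z₁ / u₁) + (u₂ + s * t * z₂ / u₂)) := by
      intro t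
      rw [mul_assoc, sum_mul_sum, mul_sum]
      refine sum_congr rfl fun u₁ _ => ?_
      rw [mul_sum]
      refine sum_congr rfl fun u₂ _ => ?_
      rw [AddChar.map_add_eq_mul ψ (s + t + _), AddChar.map_add_eq_mul ψ (s + t)]
      ring
    rw [sum_congr rfl fun t _ => this t, sum_comm]
    exact sum_congr rfl fun u₁ _ => sum_comm
  have rhs : ∑ w, ∑ n, (α * γ₂⁻¹) w * β n *
        ((∑ P, (α * γ₁⁻¹) P * ψ (P * (1 + n - w))) *
          ∑ R, (β * γ₂⁻¹) R * ψ (R * (-n + w * z₂ + w * n * z₁))) =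
      ∑ P, ∑ w, ∑ R, ∑ n, (α * γ₂⁻¹) w * β n * (α * γ₁⁻¹) P * (β * γ₂⁻¹) R *
        ψ (P * (1 + n - w) + R * (-n + w * z₂ + w * n * z₁)) := by
    refine Eq.trans ?_ sum_comm
    refine sum_congr rfl fun w _ => ?_
    have : ∀ n, (α * γ₂⁻¹) w * β n *
        ((∑ P, (α * γ₁⁻¹) P * ψ (P * (1 + n - w))) *
          ∑ R, (β * γ₂⁻¹) R * ψ (R * (-n + w * z₂ + w * n * z₁))) =
        ∑ P, ∑ R, (α * γ₂⁻¹) w * β n * (α * γ₁⁻¹) P * (β * γ₂⁻¹) R *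
        ψ (P * (1 + n - w) + R * (-n + w * z₂ + w * n * z₁)) := by
      intro n
      rw [sum_mul_sum, mul_sum]
      refine sum_congr rfl fun P _ => ?_
      rw [mul_sum]
      refine sum_congr rfl fun R _ => ?_
      rw [AddChar.map_add_eq_mul]
      ring
    rw [sum_congr rfl fun n _ => this n, sum_comm]
    exact sum_congr rfl fun P _ => sum_comm
  rw [lhs, rhs, mul_sum]
  refine sum_congr rfl fun P _ => ?_
  -- The order `u₁, s, u₂, t` lets each variable be rescaled by a factor depending only on those
  -- already fixed. When `P`, `w` or `R` is `0`, both sides vanish through a character value at `0`.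
  rcases eq_or_ne P 0 with rfl | hP
  · simp [MulChar.map_zero]
  rw [← sum_mul_left (neg_ne_zero.2 hP), mul_sum]
  refine sum_congr rfl fun w _ => ?_
  rcases eq_or_ne w 0 with rfl | hw
  · simp [MulChar.map_zero]
  rw [← sum_mul_left (mul_ne_zero hw hz₂), mul_sum]
  refine sum_congr rfl fun R _ => ?_
  rcases eq_or_ne R 0 with rfl | hR
  · simp [MulChar.map_zero]
  rw [← sum_mul_left (neg_ne_zero.2 hR), mul_sum]
  refine sum_congr rfl fun n _ => ?_
  have e : -P * w + -R * n + (P + -P * w * (-R * n) * z₁ / P) +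
      (w * z₂ * R + -P * w * (-R * n) * z₂ / (w * z₂ * R)) =
      P * (1 + n - w) + R * (-n + w * z₂ + w * n * z₁) := by
    field_simp
    ring
  rw [e]
  simp only [MulChar.mul_apply, map_mul, mulChar_neg _ P, mulChar_neg _ R]
  have : γ₂ (-1) ≠ 0 := mulChar_ne_zero _ (by simp)
  ring

variable [CharZero K]

/-- Reflection is applied to all four denominators. The signs `ν₁(-1)`, `ν₂(-1)` each occur twice
and cancel; the four factors `1 / q` meet `g°(ε)² = q²`. -/
lemma F4_summand_eq (hψ : ψ ≠ 1) (α β γ₁ γ₂ ν₁ ν₂ : MulChar k K) (z₁ z₂ : k) :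
    poch ψ α (ν₁ * ν₂) * poch ψ β (ν₁ * ν₂) /
        (pochCirc ψ γ₁ ν₁ * pochCirc ψ γ₂ ν₂ * pochCirc ψ 1 ν₁ * pochCirc ψ 1 ν₂) *
        (ν₁ z₁ * ν₂ z₂) =
      (γ₁ * γ₂) (-1) * gCirc ψ γ₁ * gCirc ψ γ₂ / ((Fintype.card k : K) ^ 2 * g ψ α * g ψ β) *
        (g ψ (α * (ν₁ * ν₂)) * g ψ (β * (ν₁ * ν₂)) * ((g ψ (γ₁ * ν₁)⁻¹ * g ψ ν₁⁻¹ * ν₁ z₁) *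
            (g ψ (γ₂ * ν₂)⁻¹ * g ψ ν₂⁻¹ * ν₂ z₂))) := by
  have hq : (Fintype.card k : K) ≠ 0 := card_cast_ne_zero
  have h1 : gCirc ψ (1 : MulChar k K) = Fintype.card k := by simp [gCirc, g_one ψ hψ]
  have split : ∀ A B a b H₁ H₂ H₃ H₄ G₁ G₂ q X : K,
      A / a * (B / b) / (H₁ / G₁ * (H₂ / G₂) * (H₃ / q) * (H₄ / q)) * X =
        G₁ * G₂ * q ^ 2 * a⁻¹ * b⁻¹ * (A * B * (H₁⁻¹ * H₂⁻¹ * H₃⁻¹ * H₄⁻¹)) * X := by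
    intros
    simp only [div_eq_mul_inv, mul_inv, inv_inv]
    ring
  have collect : ∀ {q n₁ n₂ : K} (A B C D E F X Y Z W G H a b : K), q ≠ 0 → n₁ * n₁ = 1 →
      n₂ * n₂ = 1 →
      G * H * q ^ 2 * a⁻¹ * b⁻¹ * (A * B * (Z * n₁ * C / q * (W * n₂ * D / q) * (n₁ * E / q) *
        (n₂ * F / q))) * (X * Y) =
      Z * W * G * H / (q ^ 2 * a * b) * (A * B * (C * E * X * (D * F * Y))) := by
    intro q n₁ n₂ A B C D E F X Y Z W G H a b hq s₁ s₂
    rw [show (Z * n₁ * C / q * (W * n₂ * D / q) * (n₁ * E / q) * (n₂ * F / q)) =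
      (n₁ * n₁) * (n₂ * n₂) * (Z * W * C * D * E * F * q⁻¹ ^ 4) by ring, s₁, s₂]
    have hq2 : q ^ 2 * q⁻¹ ^ 4 = (q ^ 2)⁻¹ := by field_simp
    rw [div_eq_mul_inv, mul_inv, mul_inv, ← hq2]
    ring
  simp only [poch, pochCirc, h1, one_mul]
  rw [split, inv_gCirc ψ hψ, inv_gCirc ψ hψ, inv_gCirc ψ hψ, inv_gCirc ψ hψ, MulChar.mul_apply,
    MulChar.mul_apply, MulChar.mul_apply]
  exact collect _ _ _ _ _ _ _ _ _ _ _ _ _ _ hq (mulChar_neg_one_mul_self ν₁)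
    (mulChar_neg_one_mul_self ν₂)

variable [IsAlgClosed K]

/-- `F₄` as a sum of values of the additive character. -/
lemma F4_eq_exponential_sum (hψ : ψ ≠ 1) (α β γ₁ γ₂ : MulChar k K) {z₁ z₂ : k} (hz₁ : z₁ ≠ 0)
    (hz₂ : z₂ ≠ 0) :
    F4 ψ α β γ₁ γ₂ z₁ z₂ =
      (γ₁ * γ₂) (-1) * gCirc ψ γ₁ * gCirc ψ γ₂ / ((Fintype.card k : K) ^ 2 * g ψ α * g ψ β) *
        ∑ s, ∑ t, α s * β t * ψ (s + t) * (∑ u, γ₁⁻¹ u * ψ (u + s * t * z₁ / u)) *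
          ∑ u, γ₂⁻¹ u * ψ (u + s * t * z₂ / u) := by
  let : Fintype (MulChar k K) := Fintype.ofFinite _
  have hq : (Fintype.card k : K) ≠ 0 := card_cast_ne_zero
  have hq1 : 1 - (Fintype.card k : K) ≠ 0 := by
    rw [sub_ne_zero]
    exact_mod_cast (Fintype.one_lt_card (α := k)).ne
  have hα := g_ne_zero ψ hψ α
  have hβ := g_ne_zero ψ hψ β
  have term : ∀ ν : MulChar k K × MulChar k K,
      poch ψ α (ν.1 * ν.2) * poch ψ β (ν.1 * ν.2) /
        (pochCirc ψ γ₁ ν.1 * pochCirc ψ γ₂ ν.2 * pochCirc ψ 1 ν.1 * pochCirc ψ 1 ν.2) *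
        (ν.1 z₁ * ν.2 z₂) =
      (γ₁ * γ₂) (-1) * gCirc ψ γ₁ * gCirc ψ γ₂ / ((Fintype.card k : K) ^ 2 * g ψ α * g ψ β) *
        ∑ s, ∑ t, α s * β t * ψ (s + t) *
          ((g ψ (γ₁ * ν.1)⁻¹ * g ψ ν.1⁻¹ * ν.1 (s * t * z₁)) *
            (g ψ (γ₂ * ν.2)⁻¹ * g ψ ν.2⁻¹ * ν.2 (s * t * z₂))) := by
    rintro ⟨ν₁, ν₂⟩
    -- Opening the Gauss sums of `αν₁ν₂` and `βν₁ν₂` over `s` and `t` moves `s t` into the arguments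
    -- of `ν₁` and `ν₂`.
    have e : ∑ s, ∑ t, α s * β t * ψ (s + t) *
          ((g ψ (γ₁ * ν₁)⁻¹ * g ψ ν₁⁻¹ * ν₁ (s * t * z₁)) *
            (g ψ (γ₂ * ν₂)⁻¹ * g ψ ν₂⁻¹ * ν₂ (s * t * z₂))) =
        g ψ (α * (ν₁ * ν₂)) * g ψ (β * (ν₁ * ν₂)) * ((g ψ (γ₁ * ν₁)⁻¹ * g ψ ν₁⁻¹ * ν₁ z₁) *
            (g ψ (γ₂ * ν₂)⁻¹ * g ψ ν₂⁻¹ * ν₂ z₂)) := by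
      rw [show g ψ (α * (ν₁ * ν₂)) = -gaussSum (α * (ν₁ * ν₂)) ψ from rfl,
        show g ψ (β * (ν₁ * ν₂)) = -gaussSum (β * (ν₁ * ν₂)) ψ from rfl, neg_mul_neg, gaussSum,
        gaussSum, sum_mul_sum, sum_mul]
      refine sum_congr rfl fun s _ => ?_
      rw [sum_mul]
      refine sum_congr rfl fun t _ => ?_
      simp only [MulChar.mul_apply, map_mul, AddChar.map_add_eq_mul]
      ring
    rw [e]
    exact F4_summand_eq ψ hψ α β γ₁ γ₂ ν₁ ν₂ _ _
  rw [F4, finsum_eq_sum_of_fintype, sum_congr rfl fun ν _ => term ν, ← mul_sum,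
    mul_left_comm]
  congr 1
  rw [sum_comm, mul_sum]
  refine sum_congr rfl fun s _ => ?_
  rw [sum_comm, mul_sum]
  refine sum_congr rfl fun t _ => ?_
  rcases eq_or_ne s 0 with rfl | hs
  · simp [MulChar.map_zero]
  rcases eq_or_ne t 0 with rfl | ht
  · simp [MulChar.map_zero]
  rw [← mul_sum, ← univ_product_univ, sum_product]
  simp only
  rw [← sum_mul_sum, sum_mulChar_g_mul_g ψ γ₁ (mul_ne_zero (mul_ne_zero hs ht) hz₁),
    sum_mulChar_g_mul_g ψ γ₂ (mul_ne_zero (mul_ne_zero hs ht) hz₂)]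
  field_simp
  ring

/-- `J · F₄` as a character sum over the plane. -/
lemma J_mul_F4_eq_sum (hψ : ψ ≠ 1) {α β γ₁ γ₂ : MulChar k K} (hα : α ≠ 1) (hβ : β ≠ 1)
    (hαγ : α⁻¹ * γ₁ ≠ 1) (hβγ : β⁻¹ * γ₂ ≠ 1) {z₁ z₂ : k} (hz₁ : z₁ ≠ 0) (hz₂ : z₂ ≠ 0) :
    J α β γ₁ γ₂ * F4 ψ α β γ₁ γ₂ z₁ z₂ =
      γ₂⁻¹ z₂ * ∑ w, ∑ n, (α * γ₂⁻¹) w * β n * (α⁻¹ * γ₁) (1 + n - w) *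
        (β⁻¹ * γ₂) (-n + w * z₂ + w * n * z₁) := by
  have hq : (Fintype.card k : K) ≠ 0 := card_cast_ne_zero
  have h1 := g_ne_zero ψ hψ α
  have h2 := g_ne_zero ψ hψ β
  have h3 := gCirc_ne_zero ψ hψ γ₁
  have h4 := gCirc_ne_zero ψ hψ γ₂
  rw [J, j_eq_g_mul_g_div_gCirc ψ hψ hα, j_eq_g_mul_g_div_gCirc ψ hψ hβ, mul_inv_cancel_left,
    mul_inv_cancel_left, F4_eq_exponential_sum ψ hψ α β γ₁ γ₂ hz₁ hz₂,
    exponential_sum_change_of_variables ψ α β γ₁ γ₂ hz₂]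
  -- The sums over `P` and `R` are recognised as Fourier expansions of the two remaining character
  -- values; this is where `α⁻¹γ₁` and `β⁻¹γ₂` must be non-trivial.
  have term : ∀ w n : k, (α * γ₂⁻¹) w * β n * (α⁻¹ * γ₁) (1 + n - w) *
        (β⁻¹ * γ₂) (-n + w * z₂ + w * n * z₁) =
      ((α⁻¹ * γ₁) (-1) * g ψ (α⁻¹ * γ₁) / (Fintype.card k : K)) *
      ((β⁻¹ * γ₂) (-1) * g ψ (β⁻¹ * γ₂) / (Fintype.card k : K)) *
      ((α * γ₂⁻¹) w * β n *
        ((∑ P, (α * γ₁⁻¹) P * ψ (P * (1 + n - w))) *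
          ∑ R, (β * γ₂⁻¹) R * ψ (R * (-n + w * z₂ + w * n * z₁)))) := by
    intro w n
    rw [mulChar_apply_eq_sum ψ hψ hαγ (1 + n - w), mulChar_apply_eq_sum ψ hψ hβγ (-n + _ + _),
      mul_inv, mul_inv, inv_inv, inv_inv]
    ring
  simp_rw [term, ← mul_sum]
  generalize ∑ w, ∑ n, (α * γ₂⁻¹) w * β n *
        ((∑ P, (α * γ₁⁻¹) P * ψ (P * (1 + n - w))) *
          ∑ R, (β * γ₂⁻¹) R * ψ (R * (-n + w * z₂ + w * n * z₁))) = E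
  simp only [MulChar.mul_apply, MulChar.inv_apply' _ (-1 : k), inv_neg, inv_one]
  field_simp

end IntegralRepresentation


/-! ### The birational change of variables and its three exceptional lines. -/

section Plane

variable {k K : Type*} [Field k] [Field K]

/-- The summand of the character sum which counts the points of `S_{4,λ}`. -/
noncomputable def surfaceTerm (α β γ₁ γ₂ : MulChar k K) (x y u v : k) : K :=
  α u * β v * (α⁻¹ * γ₁) (1 - u) * (β⁻¹ * γ₂) (1 - v) * (α * γ₁⁻¹ * γ₂⁻¹) (1 - x * u) *
    (β * γ₁⁻¹ * γ₂⁻¹) (1 - y * v) * ((α * β)⁻¹ * γ₁ * γ₂) (1 - x * u - y * v)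

/-- The summand of the character sum which represents `J · F₄`. -/
noncomputable def conicTerm (α β γ₁ γ₂ : MulChar k K) (x y w n : k) : K :=
  γ₂⁻¹ (y * (1 - x)) * ((α * γ₂⁻¹) w * β n * (α⁻¹ * γ₁) (1 + n - w) *
    (β⁻¹ * γ₂) (-n + w * (y * (1 - x)) + w * n * (x * (1 - y))))

/-- For this choice of `z₁, z₂`, the linear form and the conic both factor into the linear forms of
the surface (`e₁`, `e₂`). The constant `(1 - x) y` cancels against the prefactor. -/
lemma conicTerm_eq_surfaceTerm (α β γ₁ γ₂ : MulChar k K) {x y u v : k} (hx1 : 1 - x ≠ 0)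
    (hy : y ≠ 0) (hu : u ≠ 0) (h₁ : 1 - x * u ≠ 0) (h₂ : 1 - y * v ≠ 0)
    (h₃ : 1 - x * u - y * v ≠ 0) :
    conicTerm α β γ₁ γ₂ x y (u / (1 - y * v))
        ((1 - x) * y * u * v / ((1 - x * u) * (1 - y * v))) =
      surfaceTerm α β γ₁ γ₂ x y u v := by
  have e₁ : 1 + (1 - x) * y * u * v / ((1 - x * u) * (1 - y * v)) - u / (1 - y * v) =
      (1 - u) * (1 - x * u - y * v) / ((1 - x * u) * (1 - y * v)) := by
    field_simp
    ring
  have e₂ : -((1 - x) * y * u * v / ((1 - x * u) * (1 - y * v))) +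
      u / (1 - y * v) * (y * (1 - x)) +
      u / (1 - y * v) * ((1 - x) * y * u * v / ((1 - x * u) * (1 - y * v))) * (x * (1 - y)) =
      (1 - x) * y * u * (1 - v) * (1 - x * u - y * v) /
        ((1 - x * u) * ((1 - y * v) * (1 - y * v))) := by
    field_simp
    ring
  rw [conicTerm, surfaceTerm, e₁, e₂]
  have n₁ := fun χ : MulChar k K => mulChar_ne_zero χ hx1
  have n₂ := fun χ : MulChar k K => mulChar_ne_zero χ hy
  have n₃ := fun χ : MulChar k K => mulChar_ne_zero χ hu
  have n₄ := fun χ : MulChar k K => mulChar_ne_zero χ h₁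
  have n₅ := fun χ : MulChar k K => mulChar_ne_zero χ h₂
  have n₆ := fun χ : MulChar k K => mulChar_ne_zero χ h₃
  simp only [mul_inv, MulChar.mul_apply, MulChar.inv_apply_eq_inv', map_mul, mulChar_div]
  have a₁ := n₁ α; have a₂ := n₂ α; have a₃ := n₃ α; have a₄ := n₄ α; have a₅ := n₅ α
  have a₆ := n₆ α
  have b₁ := n₁ β; have b₂ := n₂ β; have b₃ := n₃ β; have b₄ := n₄ β; have b₅ := n₅ β
  have b₆ := n₆ β
  have c₁ := n₁ γ₁; have c₂ := n₂ γ₁; have c₃ := n₃ γ₁; have c₄ := n₄ γ₁; have c₅ := n₅ γ₁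
  have d₁ := n₁ γ₂; have d₂ := n₂ γ₂; have d₃ := n₃ γ₂; have d₄ := n₄ γ₂; have d₅ := n₅ γ₂
  -- These values may vanish, so they are made opaque and only the non-zero ones are cancelled.
  generalize (α (1 - u))⁻¹ = X, γ₁ (1 - u) = X', (β (1 - v))⁻¹ = Y, γ₂ (1 - v) = Y', β v = Z
  clear e₁ e₂ n₁ n₂ n₃ n₄ n₅ n₆
  field_simp

variable [Fintype k]

lemma sum_conicTerm_generic [DecidableEq k] (α β γ₁ γ₂ : MulChar k K) {x y : k}
    (hx1 : 1 - x ≠ 0) (hy : y ≠ 0) :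
    ∑ p : k × k with p.1 ≠ 0 ∧ 1 - x * p.1 ≠ 0 ∧ p.2 - (1 - x) * p.1 ≠ 0 ∧ x * p.2 - (1 - x) ≠ 0,
        conicTerm α β γ₁ γ₂ x y p.1 p.2 =
      ∑ u, ∑ v, surfaceTerm α β γ₁ γ₂ x y u v := by
  have h : ∑ u, ∑ v, surfaceTerm α β γ₁ γ₂ x y u v =
      ∑ p : k × k with p.1 ≠ 0 ∧ 1 - x * p.1 ≠ 0 ∧ 1 - y * p.2 ≠ 0 ∧
        1 - x * p.1 - y * p.2 ≠ 0, surfaceTerm α β γ₁ γ₂ x y p.1 p.2 := by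
    rw [← Fintype.sum_prod_type', sum_filter_of_ne]
    intro p _ hp
    -- Where the map is undefined or not invertible, a factor of the surface summand is a character
    -- at `0`.
    refine ⟨?_, ?_, ?_, ?_⟩ <;> intro h0 <;> apply hp <;> rw [surfaceTerm, h0] <;>
      simp [MulChar.map_zero]
  rw [h]
  symm
  refine sum_nbij'
    (fun p => (p.1 / (1 - y * p.2),
      (1 - x) * y * p.1 * p.2 / ((1 - x * p.1) * (1 - y * p.2))))
    (fun p => ((p.2 - (1 - x) * p.1) / (x * p.2 - (1 - x)),
      -((1 - x * p.1) * p.2) / (p.1 * y * (x * p.2 - (1 - x))))) ?_ ?_ ?_ ?_ ?_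
  · rintro ⟨u, v⟩ hp
    simp only [mem_filter, mem_univ, true_and] at hp ⊢
    obtain ⟨hu, h₁, h₂, h₃⟩ := hp
    have e₁ : 1 - x * (u / (1 - y * v)) = (1 - x * u - y * v) / (1 - y * v) := by
      field_simp
      ring
    have e₂ : (1 - x) * y * u * v / ((1 - x * u) * (1 - y * v)) - (1 - x) * (u / (1 - y * v)) =
        (1 - x) * u * (-(1 - x * u - y * v)) / ((1 - x * u) * (1 - y * v)) := by
      field_simp
      ring
    have e₃ : x * ((1 - x) * y * u * v / ((1 - x * u) * (1 - y * v))) - (1 - x) =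
        (1 - x) * (-(1 - x * u - y * v)) / ((1 - x * u) * (1 - y * v)) := by
      field_simp
      ring
    rw [e₁, e₂, e₃]
    have := neg_ne_zero.2 h₃
    refine ⟨by positivity, by positivity, by positivity, by positivity⟩
  · rintro ⟨w, n⟩ hp
    simp only [mem_filter, mem_univ, true_and] at hp ⊢
    obtain ⟨hw, h₁, h₂, h₃⟩ := hp
    have e₁ : 1 - x * ((n - (1 - x) * w) / (x * n - (1 - x))) =
        (1 - x) * (-(1 - x * w)) / (x * n - (1 - x)) := by
      field_simp
      ring
    have e₂ : 1 - y * (-((1 - x * w) * n) / (w * y * (x * n - (1 - x)))) =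
        (n - (1 - x) * w) / (w * (x * n - (1 - x))) := by
      field_simp
      ring
    have e₃ : 1 - x * ((n - (1 - x) * w) / (x * n - (1 - x))) -
        y * (-((1 - x * w) * n) / (w * y * (x * n - (1 - x)))) =
        (1 - x * w) * (n - (1 - x) * w) / (w * (x * n - (1 - x))) := by
      field_simp
      ring
    rw [e₃, e₂, e₁]
    have := neg_ne_zero.2 h₁
    refine ⟨by positivity, by positivity, by positivity, by positivity⟩
  · rintro ⟨u, v⟩ hp
    simp only [mem_filter, mem_univ, true_and] at hp
    obtain ⟨hu, h₁, h₂, h₃⟩ := hp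
    have h₃' := neg_ne_zero.2 h₃
    have e₁ : 1 - x * (u / (1 - y * v)) = (1 - x * u - y * v) / (1 - y * v) := by
      field_simp
      ring
    have e₂ : (1 - x) * y * u * v / ((1 - x * u) * (1 - y * v)) - (1 - x) * (u / (1 - y * v)) =
        (1 - x) * u * (-(1 - x * u - y * v)) / ((1 - x * u) * (1 - y * v)) := by
      field_simp
      ring
    have e₃ : x * ((1 - x) * y * u * v / ((1 - x * u) * (1 - y * v))) - (1 - x) =
        (1 - x) * (-(1 - x * u - y * v)) / ((1 - x * u) * (1 - y * v)) := by
      field_simp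
      ring
    ext
    · simp only
      rw [e₂, e₃]
      field_simp
    · simp only
      rw [e₁, e₃]
      field_simp
  · rintro ⟨w, n⟩ hp
    simp only [mem_filter, mem_univ, true_and] at hp
    obtain ⟨hw, h₁, h₂, h₃⟩ := hp
    have h₁' := neg_ne_zero.2 h₁
    have e₁ : 1 - x * ((n - (1 - x) * w) / (x * n - (1 - x))) =
        (1 - x) * (-(1 - x * w)) / (x * n - (1 - x)) := by
      field_simp
      ring
    have e₂ : 1 - y * (-((1 - x * w) * n) / (w * y * (x * n - (1 - x)))) =
        (n - (1 - x) * w) / (w * (x * n - (1 - x))) := by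
      field_simp
      ring
    ext
    · simp only
      rw [e₂]
      field_simp
      exact div_self (by rwa [mul_comm n])
    · simp only
      rw [e₁, e₂]
      field_simp
  · rintro ⟨u, v⟩ hp
    simp only [mem_filter, mem_univ, true_and] at hp
    obtain ⟨hu, h₁, h₂, h₃⟩ := hp
    exact (conicTerm_eq_surfaceTerm α β γ₁ γ₂ hx1 hy hu h₁ h₂ h₃).symm

/-- The inverse map has its pole along this line. Here the linear form and the conic are both
proportional to `x⁻¹ - w`, so one Jacobi sum remains. -/
lemma sum_conicTerm_line_infinity (α β γ₁ γ₂ : MulChar k K) {x y : k} (hx : x ≠ 0)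
    (hx1 : 1 - x ≠ 0) :
    ∑ w, conicTerm α β γ₁ γ₂ x y w ((1 - x) / x) = -S0 α β γ₁ γ₂ x y := by
  have hs := sum_mulChar_sub (α * γ₂⁻¹) ((α * β)⁻¹ * γ₁ * γ₂) (inv_ne_zero hx)
  rw [jacobiSum_eq_mul_jacobiSum,
    show (α * γ₂⁻¹ * ((α * β)⁻¹ * γ₁ * γ₂))⁻¹ = β * γ₁⁻¹ by
      rw [inv_eq_iff_eq_inv]; simp only [mul_inv, inv_inv]; rw [mul_mul_mul_comm]; group] at hs
  have term : ∀ w, conicTerm α β γ₁ γ₂ x y w ((1 - x) / x) =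
      γ₂⁻¹ y * β⁻¹ x * (β⁻¹ * γ₂) (-1) *
        ((α * γ₂⁻¹) w * ((α * β)⁻¹ * γ₁ * γ₂) (x⁻¹ - w)) := by
    intro w
    have e₁ : 1 + (1 - x) / x - w = x⁻¹ - w := by field_simp; ring
    have e₂ : -((1 - x) / x) + w * (y * (1 - x)) + w * ((1 - x) / x) * (x * (1 - y)) =
        (1 - x) * (-1) * (x⁻¹ - w) := by field_simp; ring
    rw [conicTerm, e₁, e₂]
    have := mulChar_ne_zero β hx1
    have := mulChar_ne_zero γ₂ hx1
    simp only [mul_inv, MulChar.mul_apply, MulChar.inv_apply_eq_inv', map_mul, div_eq_mul_inv,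
      mulChar_inv]
    generalize (α (x⁻¹ - w))⁻¹ = A, γ₁ (x⁻¹ - w) = B, (β (x⁻¹ - w))⁻¹ = C, γ₂ (x⁻¹ - w) = D,
      (γ₂ w)⁻¹ = E, (γ₂ y)⁻¹ = F, (β x)⁻¹ = G, (β (-1))⁻¹ = H
    field_simp
  simp_rw [term]
  rw [← mul_sum, hs, S0, j]
  have := mulChar_ne_zero α hx
  have := mulChar_ne_zero β hx
  have := mulChar_ne_zero γ₂ hx
  have := mulChar_ne_zero β (neg_ne_zero.2 (one_ne_zero (α := k)))
  have := mulChar_ne_zero γ₂ (neg_ne_zero.2 (one_ne_zero (α := k)))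
  have s := mulChar_neg_one_mul_self β
  simp only [mul_inv, MulChar.mul_apply, MulChar.inv_apply_eq_inv', mulChar_inv]
  generalize jacobiSum (α * γ₂⁻¹) (β * γ₁⁻¹) = I
  field_simp
  linear_combination (-α (-1) * I * (γ₂ y)⁻¹ * (γ₁ x)⁻¹) * s

/-- The inverse map contracts this line to `(u, v) = (x⁻¹, 0)`; both forms become multiples of `(1 -
x) / x - n`. -/
lemma sum_conicTerm_line_left (α β γ₁ γ₂ : MulChar k K) {x y : k} (hx : x ≠ 0)
    (hx1 : 1 - x ≠ 0) (hy : y ≠ 0) :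
    ∑ n, conicTerm α β γ₁ γ₂ x y x⁻¹ n = -S1 α β γ₁ γ₂ x y := by
  have hn : (1 - x) / x ≠ 0 := div_ne_zero hx1 hx
  have hs := sum_mulChar_sub β ((α * β)⁻¹ * γ₁ * γ₂) hn
  rw [jacobiSum_comm] at hs
  have term : ∀ n, conicTerm α β γ₁ γ₂ x y x⁻¹ n =
      γ₂⁻¹ (y * (1 - x)) * (α * γ₂⁻¹) x⁻¹ * (α⁻¹ * γ₁) (-1) * (β⁻¹ * γ₂) y *
        (β n * ((α * β)⁻¹ * γ₁ * γ₂) ((1 - x) / x - n)) := by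
    intro n
    have e₁ : 1 + n - x⁻¹ = (-1) * ((1 - x) / x - n) := by field_simp; ring
    have e₂ : -n + x⁻¹ * (y * (1 - x)) + x⁻¹ * n * (x * (1 - y)) = y * ((1 - x) / x - n) := by
      field_simp; ring
    rw [conicTerm, e₁, e₂, map_mul (α⁻¹ * γ₁), map_mul (β⁻¹ * γ₂)]
    simp only [mul_inv, MulChar.mul_apply]
    ring
  simp_rw [term]
  rw [← mul_sum, hs, S1, j, show x - 1 = (-1) * (1 - x) by ring]
  have := mulChar_ne_zero α hx
  have := mulChar_ne_zero β hx
  have := mulChar_ne_zero γ₁ hx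
  have := mulChar_ne_zero γ₂ hx
  have := mulChar_ne_zero α hx1
  have := mulChar_ne_zero β hx1
  have := mulChar_ne_zero γ₂ hx1
  have := mulChar_ne_zero γ₂ hy
  simp only [mul_inv, MulChar.mul_apply, MulChar.inv_apply_eq_inv', map_mul, mulChar_inv,
    mulChar_div]
  generalize jacobiSum (α⁻¹ * β⁻¹ * γ₁ * γ₂) β = I
  field_simp

/-- The inverse map contracts this line to `(u, v) = (0, y⁻¹)`; the conic splits as a constant times
`w (1 - x w)`. -/
lemma sum_conicTerm_line_right (α β γ₁ γ₂ : MulChar k K) {x y : k} (hx : x ≠ 0)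
    (hx1 : 1 - x ≠ 0) :
    ∑ w, conicTerm α β γ₁ γ₂ x y w ((1 - x) * w) = -S2 α β γ₁ γ₂ x y := by
  have term : ∀ w, conicTerm α β γ₁ γ₂ x y w ((1 - x) * w) =
      γ₂⁻¹ y * (β⁻¹ * γ₂) (y - 1) * (α w * ((α * β)⁻¹ * γ₁ * γ₂) (1 - x * w)) := by
    intro w
    rcases eq_or_ne w 0 with rfl | hw
    · simp [conicTerm, MulChar.map_zero]
    have e₁ : 1 + (1 - x) * w - w = 1 - x * w := by ring
    have e₂ : -((1 - x) * w) + w * (y * (1 - x)) + w * ((1 - x) * w) * (x * (1 - y)) =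
        (1 - x) * (y - 1) * w * (1 - x * w) := by ring
    rw [conicTerm, e₁, e₂]
    have := mulChar_ne_zero β hx1
    have := mulChar_ne_zero γ₂ hx1
    have := mulChar_ne_zero β hw
    have := mulChar_ne_zero γ₂ hw
    simp only [mul_inv, MulChar.mul_apply, MulChar.inv_apply_eq_inv', map_mul]
    field_simp
  simp_rw [term]
  rw [← mul_sum, ← sum_mul_left (inv_ne_zero hx), S2, j, jacobiSum_comm, jacobiSum]
  simp_rw [mul_inv_cancel_left₀ hx, map_mul α, mul_assoc (α x⁻¹), ← mul_sum]
  rw [MulChar.inv_apply' α]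
  ring

lemma sum_conicTerm_eq (α β γ₁ γ₂ : MulChar k K) {x y : k} (hx : x ≠ 0)
    (hx1 : 1 - x ≠ 0) (hy : y ≠ 0) :
    ∑ w, ∑ n, conicTerm α β γ₁ γ₂ x y w n = ∑ u, ∑ v, surfaceTerm α β γ₁ γ₂ x y u v -
      (S0 α β γ₁ γ₂ x y + S1 α β γ₁ γ₂ x y + S2 α β γ₁ γ₂ x y) := by
  classical
  have split : ∀ w n, conicTerm α β γ₁ γ₂ x y w n =
      (if w ≠ 0 ∧ 1 - x * w ≠ 0 ∧ n - (1 - x) * w ≠ 0 ∧ x * n - (1 - x) ≠ 0 then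
        conicTerm α β γ₁ γ₂ x y w n else 0) +
      ((if n = (1 - x) / x then conicTerm α β γ₁ γ₂ x y w n else 0) +
      (if w = x⁻¹ then conicTerm α β γ₁ γ₂ x y w n else 0) +
      (if n = (1 - x) * w then conicTerm α β γ₁ γ₂ x y w n else 0)) := by
    intro w n
    have h₁ : 1 - x * w = 0 ↔ w = x⁻¹ := by
      rw [sub_eq_zero, ← one_div, eq_div_iff hx, mul_comm, eq_comm]
    have h₂ : x * n - (1 - x) = 0 ↔ n = (1 - x) / x := by
      rw [sub_eq_zero, eq_div_iff hx, mul_comm]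
    simp only [ne_eq, h₁, h₂, sub_eq_zero (a := n)]
    by_cases h0 : conicTerm α β γ₁ γ₂ x y w n = 0
    · simp [h0]
    have hw : w ≠ 0 := by
      rintro rfl
      exact h0 (by simp [conicTerm, MulChar.map_zero])
    -- The three lines meet pairwise only in this one point. It lies on `1 + n - w = 0`, where the
    -- summand vanishes, so nothing is counted twice.
    have h3 : ¬ (w = x⁻¹ ∧ n = (1 - x) / x) := by
      rintro ⟨rfl, rfl⟩
      apply h0
      have : 1 + (1 - x) / x - x⁻¹ = 0 := by field_simp; ring
      rw [conicTerm, this]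
      simp [MulChar.map_zero]
    by_cases ha : w = x⁻¹
    · have hb : n ≠ (1 - x) / x := fun h => h3 ⟨ha, h⟩
      simp [ha, hb, ← div_eq_mul_inv]
    · by_cases hb : n = (1 - x) / x
      · have hc : n ≠ (1 - x) * w := by
          intro h
          rw [hb, div_eq_mul_inv] at h
          exact ha (mul_left_cancel₀ hx1 h).symm
        simp [ha, hb, hb ▸ hc]
      · by_cases hc : n = (1 - x) * w
        · simp [ha, hc, hc ▸ hb]
        · simp [ha, hb, hc, hw]
  rw [sum_congr rfl fun w _ => sum_congr rfl fun n _ => split w n]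
  simp only [sum_add_distrib, sum_ite_eq', mem_univ, if_true]
  have hleft : ∑ w, ∑ n, (if w = x⁻¹ then conicTerm α β γ₁ γ₂ x y w n else 0) =
      ∑ n, conicTerm α β γ₁ γ₂ x y x⁻¹ n := by
    rw [sum_comm]
    simp
  rw [hleft, sum_conicTerm_line_infinity α β γ₁ γ₂ hx hx1, sum_conicTerm_line_left α β γ₁ γ₂ hx hx1
    hy, sum_conicTerm_line_right α β γ₁ γ₂ hx hx1, ← sum_conicTerm_generic α β γ₁ γ₂ hx1 hy,
    sum_filter, Fintype.sum_prod_type]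
  ring

/-- The character sum attached to the surface in terms of `F₄`. -/
lemma sum_surfaceTerm_eq_rhs4 [CharZero K] [IsAlgClosed K] {ψ : AddChar k K} (hψ : ψ ≠ 1)
    {α β γ₁ γ₂ : MulChar k K} (hα : α ≠ 1) (hβ : β ≠ 1) (hαγ : α⁻¹ * γ₁ ≠ 1)
    (hβγ : β⁻¹ * γ₂ ≠ 1) {x y : k} (hx : x ≠ 0) (hx1 : x ≠ 1) (hy : y ≠ 0) (hy1 : y ≠ 1) :
    ∑ u, ∑ v, surfaceTerm α β γ₁ γ₂ x y u v = rhs4 ψ α β γ₁ γ₂ x y := by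
  have hx1' : 1 - x ≠ 0 := sub_ne_zero.2 hx1.symm
  have hy1' : 1 - y ≠ 0 := sub_ne_zero.2 hy1.symm
  rw [rhs4, J_mul_F4_eq_sum ψ hψ hα hβ hαγ hβγ (mul_ne_zero hx hy1') (mul_ne_zero hy hx1')]
  simp_rw [mul_sum]
  exact sub_eq_iff_eq_add.1 (sum_conicTerm_eq α β γ₁ γ₂ hx hx1' hy).symm

end Plane


/-! ### Twisted point counts of `y ^ d = f` as character sums. -/

section PointCount

variable {k : Type*} [Field k] {d : ℕ}

lemma aeval_algebraMap (f : MvPolynomial (Fin 2) k) (x : Fin 2 → k) :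
    MvPolynomial.aeval (fun i => algebraMap k (AlgebraicClosure k) (x i)) f =
      algebraMap k (AlgebraicClosure k) (MvPolynomial.eval x f) :=
  MvPolynomial.aeval_algebraMap_apply (A := k) (B := AlgebraicClosure k) x f

lemma chi_zpow_eq_one {K : Type*} [Field K] {m : ℤ} (hm : (d : ℤ) ∣ m) (φ : MulChar k K) : chi d φ ^ m = 1 := by
  obtain ⟨n, rfl⟩ := hm
  ext ξ
  have h : ξ ^ d = 1 := Subtype.ext ((mem_rootsOfUnity d _).1 ξ.2)
  rw [MonoidHom.zpow_apply, zpow_mul, zpow_natCast, ← map_pow, h]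
  simp

variable [Fintype k]

lemma pos_of_dvd_card_sub_one (hd : d ∣ Fintype.card k - 1) : 0 < d :=
  Nat.pos_of_dvd_of_pos hd (Nat.sub_pos_of_lt Fintype.one_lt_card)

lemma exists_isPrimitiveRoot_of_dvd_card_sub_one (hd : d ∣ Fintype.card k - 1) :
    ∃ u : kˣ, IsPrimitiveRoot (u ^ ((Fintype.card k - 1) / d)) d := by
  obtain ⟨u, hu⟩ := IsCyclic.exists_generator (α := kˣ)
  have h1 : orderOf u = Fintype.card k - 1 := by
    rw [orderOf_eq_card_of_forall_mem_zpowers hu, Nat.card_units, Nat.card_eq_fintype_card]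
  refine ⟨u, IsPrimitiveRoot.pow (Nat.sub_pos_of_lt (Fintype.one_lt_card (α := k)))
    (h1 ▸ IsPrimitiveRoot.orderOf u) (Nat.div_mul_cancel hd).symm⟩

lemma natCard_rootsOfUnity_of_dvd_card_sub_one (hd : d ∣ Fintype.card k - 1) :
    Nat.card (rootsOfUnity d k) = d := by
  have : NeZero d := ⟨(pos_of_dvd_card_sub_one hd).ne'⟩
  obtain ⟨u, hu⟩ := exists_isPrimitiveRoot_of_dvd_card_sub_one hd
  exact hu.card_rootsOfUnity'

lemma exists_algebraMap_eq_of_pow_card_eq {z : AlgebraicClosure k}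
    (hz : z ^ Fintype.card k = z) : ∃ a : k, algebraMap k (AlgebraicClosure k) a = z := by
  have hs : (Polynomial.X ^ Fintype.card k - Polynomial.X : Polynomial k).Splits := by
    rw [Polynomial.splits_iff_card_roots, FiniteField.roots_X_pow_card_sub_X,
      FiniteField.X_pow_card_sub_X_natDegree_eq _ Fintype.one_lt_card]
    rfl
  have h := hs.roots_map (algebraMap k (AlgebraicClosure k))
  rw [FiniteField.roots_X_pow_card_sub_X] at h
  have hz' : z ∈ (Polynomial.map (algebraMap k (AlgebraicClosure k))
      (Polynomial.X ^ Fintype.card k - Polynomial.X : Polynomial k)).roots := by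
    simp [hz, FiniteField.X_pow_card_sub_X_ne_zero _ (Fintype.one_lt_card (α := k))]
  rw [h, Multiset.mem_map] at hz'
  obtain ⟨a, -, ha⟩ := hz'
  exact ⟨a, ha⟩

/-- The points of a fibre of `y ^ d = c` on which Frobenius acts as `ξ`. -/
abbrev TwistedRoots (d : ℕ) (c : k) (ξ : rootsOfUnity d k) : Type _ :=
  {y : AlgebraicClosure k // y ^ d = algebraMap k _ c ∧
    y ^ Fintype.card k = algebraMap k _ ((ξ : kˣ) : k) * y}

/-- The point of the surface over `x ∈ k²` given by a twisted root. -/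
noncomputable def twistedPoint (f : MvPolynomial (Fin 2) k) (ξ : rootsOfUnity d k)
    (p : Σ x : Fin 2 → k, TwistedRoots d (MvPolynomial.eval x f) ξ) :
    {P : CyclicSurface d f // CyclicSurface.frob^[1] P = ξ • P} :=
  ⟨⟨fun i => algebraMap k _ (p.1 i), p.2.1, by rw [p.2.2.1, aeval_algebraMap]⟩, by
    refine CyclicSurface.ext ?_ p.2.2.2
    funext i
    change algebraMap k _ (p.1 i) ^ Fintype.card k = algebraMap k _ (p.1 i)
    rw [← map_pow, FiniteField.pow_card]⟩

/-- As `ξ` fixes the `x`-coordinates, `F P = ξ P` makes them Frobenius-invariant, hence elements of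
`k`. -/
lemma twistedPoint_bijective (f : MvPolynomial (Fin 2) k) (ξ : rootsOfUnity d k) :
    Function.Bijective (twistedPoint f ξ) := by
  constructor
  · rintro ⟨x, y⟩ ⟨x', y'⟩ h
    have hP := congrArg Subtype.val h
    obtain rfl : x = x' := funext fun i =>
      (algebraMap k (AlgebraicClosure k)).injective (congrFun (congrArg CyclicSurface.x hP) i)
    obtain rfl : y = y' := Subtype.ext (congrArg CyclicSurface.y hP)
    rfl
  · rintro ⟨P, hP⟩
    have hx : ∀ i, ∃ a : k, algebraMap k (AlgebraicClosure k) a = P.x i := fun i =>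
      exists_algebraMap_eq_of_pow_card_eq (congrFun (congrArg CyclicSurface.x hP) i)
    choose x hx using hx
    have hy : P.y ^ d = algebraMap k (AlgebraicClosure k) (MvPolynomial.eval x f) := by
      rw [P.eqn, ← aeval_algebraMap]
      simp only [hx]
    exact ⟨⟨x, P.y, hy, congrArg CyclicSurface.y hP⟩,
      Subtype.ext (CyclicSurface.ext (funext hx) rfl)⟩

lemma finite_twistedRoots (hd : d ∣ Fintype.card k - 1) (c : k) (ξ : rootsOfUnity d k) :
    Finite (TwistedRoots d c ξ) := by
  classical
  refine Set.Finite.subset (Finset.finite_toSet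
    (Polynomial.nthRoots d (algebraMap k (AlgebraicClosure k) c)).toFinset) fun y hy => ?_
  rw [mem_coe, Multiset.mem_toFinset, Polynomial.mem_nthRoots (pos_of_dvd_card_sub_one hd)]
  exact hy.1

/-- The root of unity `c ^ ((q - 1) / d)` by which Frobenius acts on the roots of `y ^ d = c`. -/
def powerResidue (hd : d ∣ Fintype.card k - 1) {c : k} (hc : c ≠ 0) : rootsOfUnity d k :=
  ⟨Units.mk0 c hc ^ ((Fintype.card k - 1) / d), by
    rw [mem_rootsOfUnity, ← pow_mul, Nat.div_mul_cancel hd]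
    ext
    simpa using FiniteField.pow_card_sub_one_eq_one c hc⟩

lemma natCard_twistedRoots_zero (hd : d ∣ Fintype.card k - 1) (ξ : rootsOfUnity d k) :
    Nat.card (TwistedRoots d (0 : k) ξ) = 1 := by
  have hd0 := (pos_of_dvd_card_sub_one hd).ne'
  rw [Nat.card_eq_one_iff_unique]
  refine ⟨⟨fun a b => ?_⟩, ⟨⟨0, by simp [hd0], by simp⟩⟩⟩
  apply Subtype.ext
  have ha := a.2.1.trans (map_zero _)
  have hb := b.2.1.trans (map_zero _)
  rw [eq_zero_of_pow_eq_zero ha, eq_zero_of_pow_eq_zero hb]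

lemma pow_card_eq_of_pow_eq (hd : d ∣ Fintype.card k - 1) {c : k} (hc : c ≠ 0)
    {y : AlgebraicClosure k} (hy : y ^ d = algebraMap k _ c) :
    y ^ Fintype.card k = algebraMap k _ ((powerResidue hd hc : kˣ) : k) * y := by
  have h : ((powerResidue hd hc : kˣ) : k) = c ^ ((Fintype.card k - 1) / d) := by
    simp [powerResidue]
  rw [h, map_pow, ← hy, ← pow_mul, Nat.mul_div_cancel' hd, ← pow_succ,
    Nat.sub_add_cancel Fintype.card_pos]

lemma natCard_twistedRoots [DecidableEq (rootsOfUnity d k)] (hd : d ∣ Fintype.card k - 1) {c : k}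
    (hc : c ≠ 0) (ξ : rootsOfUnity d k) :
    Nat.card (TwistedRoots d c ξ) = if ξ = powerResidue hd hc then d else 0 := by
  classical
  have hd0 := pos_of_dvd_card_sub_one hd
  have hc' : algebraMap k (AlgebraicClosure k) c ≠ 0 := by simpa using hc
  split_ifs with h
  · subst h
    obtain ⟨u, hu⟩ := exists_isPrimitiveRoot_of_dvd_card_sub_one hd
    have hζ : IsPrimitiveRoot (algebraMap k (AlgebraicClosure k)
        ((u ^ ((Fintype.card k - 1) / d) : kˣ) : k)) d :=
      (IsPrimitiveRoot.coe_units_iff.2 hu).map_of_injective (algebraMap k _).injective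
    have e : TwistedRoots d c (powerResidue hd hc) ≃
        (Polynomial.nthRoots d (algebraMap k (AlgebraicClosure k) c)).toFinset :=
      Equiv.subtypeEquivRight fun y => by
        rw [Multiset.mem_toFinset, Polynomial.mem_nthRoots hd0]
        exact ⟨fun h => h.1, fun h => ⟨h, pow_card_eq_of_pow_eq hd hc h⟩⟩
    rw [Nat.card_congr e, Nat.card_eq_fintype_card, Fintype.card_coe,
      Multiset.toFinset_card_of_nodup (hζ.nthRoots_nodup hc'), hζ.card_nthRoots, if_pos]
    exact IsAlgClosed.exists_pow_nat_eq _ hd0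
  · rw [Nat.card_eq_zero]
    left
    refine ⟨fun y => h ?_⟩
    have hy : y.1 ≠ 0 := by
      intro h0
      have := y.2.1
      rw [h0, zero_pow hd0.ne'] at this
      exact hc' this.symm
    have := mul_right_cancel₀ hy (y.2.2.symm.trans (pow_card_eq_of_pow_eq hd hc y.2.1))
    exact Subtype.ext (Units.ext ((algebraMap k _).injective this))

variable {K : Type*} [Field K]

lemma chi_zpow_powerResidue (hd : d ∣ Fintype.card k - 1) (φ : MulChar k K) (m : ℤ) {c : k}
    (hc : c ≠ 0) : (((chi d φ ^ m) (powerResidue hd hc) : Kˣ) : K) = (phiD d φ ^ m) c := by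
  have h : ∀ χ : MulChar k K, χ c = χ.toUnitHom (Units.mk0 c hc) := fun χ => by
    rw [MulChar.coe_toUnitHom, Units.val_mk0]
  have hz : ∀ χ : MulChar k K, (χ ^ m).toUnitHom = χ.toUnitHom ^ m := fun χ =>
    map_zpow MulChar.mulEquivToUnitHom χ m
  have hp : ∀ (χ : MulChar k K) (n : ℕ), (χ ^ n).toUnitHom = χ.toUnitHom ^ n := fun χ n =>
    map_pow MulChar.mulEquivToUnitHom χ n
  rw [h, hz, phiD, hp]
  simp [chi, powerResidue]

variable [CharZero K]

/-- Over a zero of `f` the single point `y = 0` counts for every `ξ`. Elsewhere all `d` roots have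
the same twist, and `d` cancels the averaging factor. -/
lemma N_eq_sum [DecidableEq k] (hd : d ∣ Fintype.card k - 1) (f : MvPolynomial (Fin 2) k)
    (χ : rootsOfUnity d k →* Kˣ) [Fintype (rootsOfUnity d k)] :
    N (CyclicSurface d f) CyclicSurface.frob χ 1 =
      ∑ x : Fin 2 → k, if h : MvPolynomial.eval x f = 0 then 1 / (d : K) * ∑ ξ, (χ ξ : K)
        else (χ (powerResidue hd h) : K) := by
  classical
  have hd0 : (d : K) ≠ 0 := by exact_mod_cast (pos_of_dvd_card_sub_one hd).ne'
  have hfin := finite_twistedRoots (k := k) hd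
  have hcard : ∀ ξ : rootsOfUnity d k,
      (Nat.card {P : CyclicSurface d f // CyclicSurface.frob^[1] P = ξ • P} : K) =
        ∑ x : Fin 2 → k, (Nat.card (TwistedRoots d (MvPolynomial.eval x f) ξ) : K) := by
    intro ξ
    rw [← Nat.card_congr (Equiv.ofBijective _ (twistedPoint_bijective f ξ)), Nat.card_sigma, Nat.cast_sum]
  rw [N, finsum_eq_sum_of_fintype, natCard_rootsOfUnity_of_dvd_card_sub_one hd]
  simp_rw [hcard, mul_sum]
  rw [sum_comm]
  refine sum_congr rfl fun x _ => ?_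
  split_ifs with h
  · simp_rw [h, natCard_twistedRoots_zero hd, Nat.cast_one, mul_one]
  · simp_rw [natCard_twistedRoots hd h]
    rw [sum_eq_single (powerResidue hd h)]
    · rw [if_pos rfl]
      field_simp
    · intro ξ _ hξ
      simp [hξ]
    · simp

lemma N_eq_card_sq (hd : d ∣ Fintype.card k - 1) (f : MvPolynomial (Fin 2) k) (φ : MulChar k K)
    {m : ℤ} (hm : (d : ℤ) ∣ m) :
    N (CyclicSurface d f) CyclicSurface.frob (chi d φ ^ m) 1 = (Fintype.card k : K) ^ 2 := by
  classical
  have hd0 : (d : K) ≠ 0 := by exact_mod_cast (pos_of_dvd_card_sub_one hd).ne'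
  have hcard : Fintype.card (rootsOfUnity d k) = d := by
    rw [← Nat.card_eq_fintype_card, natCard_rootsOfUnity_of_dvd_card_sub_one hd]
  have hsum : ∑ ξ, (((1 : rootsOfUnity d k →* Kˣ) ξ : Kˣ) : K) = d := by
    simp only [MonoidHom.one_apply, Units.val_one, sum_const, card_univ, hcard, nsmul_eq_mul,
      mul_one]
  rw [N_eq_sum hd, chi_zpow_eq_one hm, hsum]
  simp [hd0]

variable [IsAlgClosed K]

/-- Characters separate the points of `kˣ`, and all of them are powers of `φ`. -/
lemma eq_one_of_generator_apply_eq_one {φ : MulChar k K}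
    (hφ : ∀ η : MulChar k K, η ∈ Subgroup.zpowers φ) {u : kˣ} (hu : φ u = 1) : u = 1 := by
  by_contra h
  have h' : (u : k) ≠ 1 := fun e => h (Units.ext e)
  obtain ⟨χ, hχ⟩ := MulChar.exists_apply_ne_one_of_hasEnoughRootsOfUnity k K h'
  obtain ⟨n, rfl⟩ := Subgroup.mem_zpowers_iff.1 (hφ χ)
  apply hχ
  rw [MulChar.zpow_apply_coe, ← MulChar.coe_toUnitHom, map_zpow,
    show φ.toUnitHom u = 1 from Units.ext (by rw [MulChar.coe_toUnitHom, hu]; rfl), one_zpow,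
    Units.val_one]

lemma phiD_zpow_eq_one_iff (hd : d ∣ Fintype.card k - 1) {φ : MulChar k K}
    (hφ : ∀ η : MulChar k K, η ∈ Subgroup.zpowers φ) (n : ℤ) :
    phiD d φ ^ n = 1 ↔ (d : ℤ) ∣ n := by
  constructor
  · intro h
    obtain ⟨u, hu⟩ := exists_isPrimitiveRoot_of_dvd_card_sub_one hd
    rw [← hu.zpow_eq_one_iff_dvd]
    apply eq_one_of_generator_apply_eq_one hφ
    have := congrArg (fun χ : MulChar k K => χ u) h
    simp only [phiD, MulChar.one_apply_coe] at this
    rw [← this, ← zpow_natCast, ← zpow_natCast, ← zpow_mul, ← zpow_mul, MulChar.zpow_apply_coe]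
  · rintro ⟨n, rfl⟩
    rw [zpow_mul, zpow_natCast, phiD, ← pow_mul, Nat.div_mul_cancel hd]
    have : φ ^ (Fintype.card k - 1) = 1 := by
      ext u
      rw [MulChar.pow_apply_coe, ← map_pow, FiniteField.pow_card_sub_one_eq_one _ u.ne_zero,
        map_one, MulChar.one_apply_coe]
    rw [this, one_zpow]

/-- For a non-trivial character the mean over `μ_d` is `0`, which agrees with the convention `η(0) =
0` at the zeros of `f`. -/
lemma N_eq_sum_phiD (hd : d ∣ Fintype.card k - 1) (f : MvPolynomial (Fin 2) k) {φ : MulChar k K}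
    (hφ : ∀ η : MulChar k K, η ∈ Subgroup.zpowers φ) {m : ℤ} (hm : ¬ (d : ℤ) ∣ m) :
    N (CyclicSurface d f) CyclicSurface.frob (chi d φ ^ m) 1 =
      ∑ x : Fin 2 → k, (phiD d φ ^ m) (MvPolynomial.eval x f) := by
  classical
  have hne : chi d φ ^ m ≠ 1 := by
    intro h
    apply hm
    rw [← phiD_zpow_eq_one_iff hd hφ]
    ext u
    have := chi_zpow_powerResidue hd φ m u.ne_zero
    rw [← this, h, MulChar.one_apply_coe]
    rfl
  have hsum : ∑ ξ, (((chi d φ ^ m) ξ : Kˣ) : K) = 0 := by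
    refine sum_hom_units_eq_zero ((Units.coeHom K).comp (chi d φ ^ m)) fun h => hne ?_
    ext ξ
    exact congrArg (fun f => f ξ) h
  rw [N_eq_sum hd]
  refine sum_congr rfl fun x _ => ?_
  split_ifs with h
  · rw [hsum, h, MulChar.map_zero, mul_zero]
  · exact chi_zpow_powerResidue hd φ m h

end PointCount

/-! ### The surface of `F₄`. -/

section Surface

variable {k K : Type*} [Field k] [Fintype k] [Field K] [CharZero K] [IsAlgClosed K] {d : ℕ}

/-- The condition `e ≠ 0` matters at `z = 0`: there `z ^ 0 = 1` has character value `1`, while the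
right side is `0`. This is why exponents in `{0, …, d - 1}` require the three non-divisibility
conditions. -/
lemma phiD_zpow_apply_pow (hd : d ∣ Fintype.card k - 1) {φ : MulChar k K}
    (hφ : ∀ η : MulChar k K, η ∈ Subgroup.zpowers φ) (m : ℤ) {n : ℤ} {e : ℕ} (he0 : e ≠ 0)
    (he : (d : ℤ) ∣ (e : ℤ) - n) (z : k) :
    (phiD d φ ^ m) (z ^ e) = (phiD d φ ^ (m * n)) z := by
  rw [map_pow, ← MulChar.pow_apply' _ he0, ← zpow_natCast, ← zpow_mul]
  have h : phiD d φ ^ (m * e) = phiD d φ ^ (m * n) := by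
    rw [← div_eq_one, div_eq_mul_inv, ← zpow_sub, ← mul_sub, phiD_zpow_eq_one_iff hd hφ]
    exact he.mul_left m
  rw [h]

/-- The twisted point count of `y ^ d = …` if every linear form occurs with an exponent `> 0`. -/
lemma N_eq_rhs4 {ψ : AddChar k K} (hψ : ψ ≠ 1) {φ : MulChar k K}
    (hφ : ∀ η : MulChar k K, η ∈ Subgroup.zpowers φ) (hd : d ∣ Fintype.card k - 1)
    {a b c₁ c₂ : ℤ} (ha : Int.gcd d a = 1) (hb : Int.gcd d b = 1)
    (hc₁a : Int.gcd d (c₁ - a) = 1) (hc₂b : Int.gcd d (c₂ - b) = 1)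
    {l₁ l₂ : k} (hl₁ : l₁ ≠ 0) (hl₂ : l₂ ≠ 0) (hl₁' : l₁ ≠ 1) (hl₂' : l₂ ≠ 1)
    {m : ℤ} (hm : ¬ (d : ℤ) ∣ m) {e : ℤ → ℕ} (he : ∀ n, (d : ℤ) ∣ (e n : ℤ) - n)
    (h₁ : e a ≠ 0) (h₂ : e b ≠ 0) (h₃ : e (c₁ - a) ≠ 0) (h₄ : e (c₂ - b) ≠ 0)
    (h₅ : e (a - c₁ - c₂) ≠ 0) (h₆ : e (b - c₁ - c₂) ≠ 0) (h₇ : e (c₁ + c₂ - a - b) ≠ 0) :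
    N (CyclicSurface d (poly4 e a b c₁ c₂ l₁ l₂)) CyclicSurface.frob (chi d φ ^ m) 1 =
      rhs4 ψ (phiD d φ ^ (m * a)) (phiD d φ ^ (m * b)) (phiD d φ ^ (m * c₁))
        (phiD d φ ^ (m * c₂)) l₁ l₂ := by
  have ne : ∀ {n : ℤ}, Int.gcd d n = 1 → phiD d φ ^ (m * n) ≠ 1 := by
    intro n hn h
    rw [phiD_zpow_eq_one_iff hd hφ] at h
    exact hm (Int.dvd_of_dvd_mul_left_of_gcd_one h hn)
  have quot : ∀ s t : ℤ, (phiD d φ ^ (m * s))⁻¹ * phiD d φ ^ (m * t) = phiD d φ ^ (m * (t - s)) :=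
    fun s t => by rw [← zpow_neg, ← zpow_add]; congr 1; ring
  rw [← sum_surfaceTerm_eq_rhs4 hψ (ne ha) (ne hb) (by rw [quot]; exact ne hc₁a)
    (by rw [quot]; exact ne hc₂b) hl₁ hl₁' hl₂ hl₂', N_eq_sum_phiD hd _ hφ hm,
    ← Fintype.sum_prod_type']
  refine Fintype.sum_equiv (finTwoArrowEquiv k) _ _ fun x => ?_
  have f₅ : phiD d φ ^ (m * a) * (phiD d φ ^ (m * c₁))⁻¹ * (phiD d φ ^ (m * c₂))⁻¹ =
      phiD d φ ^ (m * (a - c₁ - c₂)) := by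
    rw [← zpow_neg, ← zpow_neg, ← zpow_add, ← zpow_add]; congr 1; ring
  have f₆ : phiD d φ ^ (m * b) * (phiD d φ ^ (m * c₁))⁻¹ * (phiD d φ ^ (m * c₂))⁻¹ =
      phiD d φ ^ (m * (b - c₁ - c₂)) := by
    rw [← zpow_neg, ← zpow_neg, ← zpow_add, ← zpow_add]; congr 1; ring
  have f₇ : (phiD d φ ^ (m * a) * phiD d φ ^ (m * b))⁻¹ * phiD d φ ^ (m * c₁) *
      phiD d φ ^ (m * c₂) = phiD d φ ^ (m * (c₁ + c₂ - a - b)) := by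
    rw [← zpow_add, ← zpow_neg, ← zpow_add, ← zpow_add]; congr 1; ring
  rw [surfaceTerm, quot, quot, f₅, f₆, f₇, poly4]
  simp only [map_mul (MvPolynomial.eval x), map_pow (MvPolynomial.eval x), map_sub, map_one,
    MvPolynomial.eval_X, MvPolynomial.eval_C, map_mul (phiD d φ ^ m)]
  rw [phiD_zpow_apply_pow hd hφ m h₁ (he _), phiD_zpow_apply_pow hd hφ m h₂ (he _),
    phiD_zpow_apply_pow hd hφ m h₃ (he _), phiD_zpow_apply_pow hd hφ m h₄ (he _),
    phiD_zpow_apply_pow hd hφ m h₅ (he _), phiD_zpow_apply_pow hd hφ m h₆ (he _),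
    phiD_zpow_apply_pow hd hφ m h₇ (he _)]
  rfl

end Surface

/-! ### Exponents modulo `d`. -/

section Residues

variable {d : ℕ}

lemma dvd_res_sub (hd : d ≠ 0) (n : ℤ) : (d : ℤ) ∣ (res d n : ℤ) - n := by
  have hd' : (d : ℤ) ≠ 0 := by exact_mod_cast hd
  rw [res, Int.toNat_of_nonneg (Int.emod_nonneg n hd')]
  exact ⟨-(n / d), by linarith [Int.emod_add_mul_ediv n d]⟩

lemma res_ne_zero (hd : d ≠ 0) {n : ℤ} (hn : ¬ (d : ℤ) ∣ n) : res d n ≠ 0 := by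
  intro h
  have := dvd_res_sub hd n
  rw [h, Nat.cast_zero, zero_sub, dvd_neg] at this
  exact hn this

lemma dvd_posRes_sub (hd : d ≠ 0) (n : ℤ) : (d : ℤ) ∣ (posRes d n : ℤ) - n := by
  rw [posRes]
  split_ifs with h
  · exact dvd_sub_self_left.2 h
  · exact dvd_res_sub hd n

lemma posRes_ne_zero (hd : d ≠ 0) (n : ℤ) : posRes d n ≠ 0 := by
  rw [posRes]
  split_ifs with h
  · exact hd
  · exact res_ne_zero hd h

lemma not_dvd_of_gcd_eq_one {m n : ℤ} (hm : ¬ (d : ℤ) ∣ m) (hn : Int.gcd d n = 1) :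
    ¬ (d : ℤ) ∣ n := fun h =>
  hm (Int.dvd_of_dvd_mul_left_of_gcd_one (h.mul_left m) hn)

end Residues

end AppellFF

theorem theoremN {k K : Type*} [Field k] [Fintype k] [Field K] [CharZero K] [IsAlgClosed K]
    (ψ : AddChar k K) (hψ : ψ ≠ 1)
    (φ : MulChar k K) (hφ : ∀ η : MulChar k K, η ∈ Subgroup.zpowers φ)
    (d : ℕ) (hd : d ∣ Fintype.card k - 1)
    (a b c₁ c₂ : ℤ)
    (ha : Int.gcd d a = 1) (hb : Int.gcd d b = 1)
    (hc₁a : Int.gcd d (c₁ - a) = 1) (hc₂a : Int.gcd d (c₂ - a) = 1)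
    (hc₁b : Int.gcd d (c₁ - b) = 1) (hc₂b : Int.gcd d (c₂ - b) = 1)
    (l₁ l₂ : k) (hl₁ : l₁ ≠ 0) (hl₂ : l₂ ≠ 0) (hl₁' : l₁ ≠ 1) (hl₂' : l₂ ≠ 1)
    (m : ℤ) :
    -- the surface with exponents in `{0, …, d - 1}`
    ((d : ℤ) ∣ m →
      AppellFF.N (AppellFF.Surface4 d a b c₁ c₂ l₁ l₂) AppellFF.CyclicSurface.frob
        (AppellFF.chi d φ ^ m) 1 = (Fintype.card k : K) ^ 2) ∧
    (¬ (d : ℤ) ∣ m →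
      ¬ (d : ℤ) ∣ a - c₁ - c₂ → ¬ (d : ℤ) ∣ b - c₁ - c₂ → ¬ (d : ℤ) ∣ c₁ + c₂ - a - b →
      AppellFF.N (AppellFF.Surface4 d a b c₁ c₂ l₁ l₂) AppellFF.CyclicSurface.frob
        (AppellFF.chi d φ ^ m) 1 =
      AppellFF.rhs4 ψ (AppellFF.phiD d φ ^ (m * a)) (AppellFF.phiD d φ ^ (m * b))
        (AppellFF.phiD d φ ^ (m * c₁)) (AppellFF.phiD d φ ^ (m * c₂)) l₁ l₂) ∧
    -- the surface with exponents in `{1, …, d}`, where nothing has to be excluded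
    ((d : ℤ) ∣ m →
      AppellFF.N (AppellFF.Surface4Pos d a b c₁ c₂ l₁ l₂) AppellFF.CyclicSurface.frob
        (AppellFF.chi d φ ^ m) 1 = (Fintype.card k : K) ^ 2) ∧
    (¬ (d : ℤ) ∣ m →
      AppellFF.N (AppellFF.Surface4Pos d a b c₁ c₂ l₁ l₂) AppellFF.CyclicSurface.frob
        (AppellFF.chi d φ ^ m) 1 =
      AppellFF.rhs4 ψ (AppellFF.phiD d φ ^ (m * a)) (AppellFF.phiD d φ ^ (m * b))
        (AppellFF.phiD d φ ^ (m * c₁)) (AppellFF.phiD d φ ^ (m * c₂)) l₁ l₂) := by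
  have hd0 := (AppellFF.pos_of_dvd_card_sub_one hd).ne'
  refine ⟨AppellFF.N_eq_card_sq hd _ φ, fun hm h₅ h₆ h₇ => ?_, AppellFF.N_eq_card_sq hd _ φ,
    fun hm => ?_⟩
  -- Since `d ∤ m` excludes `d = 1`, an integer prime to `d` has a non-zero residue; this settles
  -- the first four exponents.
  · have nz : ∀ {n : ℤ}, Int.gcd d n = 1 → AppellFF.res d n ≠ 0 := fun hn =>
      AppellFF.res_ne_zero hd0 (AppellFF.not_dvd_of_gcd_eq_one hm hn)
    exact AppellFF.N_eq_rhs4 hψ hφ hd ha hb hc₁a hc₂b hl₁ hl₂ hl₁' hl₂' hm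
      (AppellFF.dvd_res_sub hd0) (nz ha) (nz hb) (nz hc₁a) (nz hc₂b)
      (AppellFF.res_ne_zero hd0 h₅) (AppellFF.res_ne_zero hd0 h₆) (AppellFF.res_ne_zero hd0 h₇)
  · have nz := AppellFF.posRes_ne_zero hd0
    exact AppellFF.N_eq_rhs4 hψ hφ hd ha hb hc₁a hc₂b hl₁ hl₂ hl₁' hl₂' hm
      (AppellFF.dvd_posRes_sub hd0) (nz _) (nz _) (nz _) (nz _) (nz _) (nz _) (nz _)
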